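/- Let $\Bbbk$ be a commutative ring. The statement concerns functors in one of two settings: (a) \emph{ordinary functors}, i.e. functors from an additive category $\mathcal V$ to $\Bbbk$-modules; (b) \emph{strict analytic functors}, i.e. (possibly infinite) direct sums, over $d\ge 0$, of homogeneous strict polynomial functors of weight $d$, from the category $\mathcal V=\mathrm P_\Bbbk$ of finitely generated projective $\Bbbk$-modules to $\Bbbk$-modules. In setting (b), subfunctors are taken in the category of strict analytic functors. An \emph{exponential functor} is a functor $E$ with a grading $E=\bigoplus_{i\ge 0}E^i$ by subfunctors, together with natural isomorphisms of graded modules $\phi:E(V)\otimes_\Bbbk E(W)\simeq E(V\oplus W)$ and $u:\Bbbk\simeq E(0)$ ($\Bbbk$ in degree $0$; in setting (b), $\phi$ is an isomorphism of strict analytic bifunctors) which are associative, unital, and graded commutative (commutative up to the Koszul sign). Then $E(V)$ is an algebra with multiplication $E(V)\otimes E(V)\simeq E(V\oplus V)\to E(V)$, the second map being induced by the sum map $V\oplus V\to V$, and with augmentation $E(V)\to E(0)\simeq\Bbbk$. Let $\overline E(V)$ be the augmentation ideal and, for $k>0$, let $Q_{-k}E(V)=\overline E(V)^k$ be its $k$-th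 power. For a functor $F$ and $n\ge 1$, let $\overline F(V)=\ker(F(V)\to F(0))$, and let the cross effect $\mathrm{cr}_nF(V_1,\dots,V_n)$ be the submodule of $\overline F(V_1\oplus\dots\oplus V_n)$ of the elements killed by $F(e_1),\dots,F(e_n)$, where $e_i$ is the projection onto $\bigoplus_{j\ne i}V_j$ followed by its inclusion into $\bigoplus_jV_j$. The functor $F$ has Eilenberg–Mac Lane degree $<n$ if $\mathrm{cr}_nF=0$ (in setting (b) this is a condition on the underlying ordinary functor). The $n$-th term of the copolynomial filtration of $F$ is the image of the composition $\mathrm{cr}_nF(V,\dots,V)\hookrightarrow F(V^{\oplus n})\to F(V)$, the second map being induced by the folding map. \textbf{Theorem.} In each of the two settings, let $E$ be an exponential functor and let $k$ be a positive integer. Then $Q_{-k}E$ is a graded subfunctor of $E$, and the quotient $E/Q_{-k}E$ has Eilenberg–Mac Lane degree $<k$. Moreover, $Q_{-k}E$ is the smallest subfunctor with this property: if $G\subset E$ is a (not necessarily graded) subfunctor such that $E/G$ has Eilenberg–Mac Lane degree $<k$, then $Q_{-k}E\subset G$. Consequently $Q_{-k}E$ is equal to the $k$-th term of the copolynomial filtration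 of $E$, and it does not depend on the exponential structure: any two exponential structures on the same functor have the same $Q_{-k}E$. -/

import Mathlib

open CategoryTheory CategoryTheory.Limits
open scoped TensorProduct ZeroObject

universe w v u₁ u

noncomputable section

attribute [instance] hasBinaryBiproducts_of_finite_biproducts

namespace ExpFun

section Ordinary

variable {k : Type u} [CommRing k] {C : Type u₁} [Category.{v} C]

/-- A subfunctor of a functor with values in `k`-modules: a family of submodules that is stable
under the action of the morphisms of the source category. -/
@[ext]
structure Subfun (F : C ⥤ ModuleCat.{w} k) where
  carrier : ∀ V : C, Submodule k (F.obj V)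
  map_mem : ∀ {V W : C} (f : V ⟶ W) {x : F.obj V}, x ∈ carrier V → (F.map f).hom x ∈ carrier W

namespace Subfun

variable {F : C ⥤ ModuleCat.{w} k}

/-- Inclusion of subfunctors. -/
instance : PartialOrder (Subfun F) where
  le G H := ∀ V, G.carrier V ≤ H.carrier V
  le_refl _ _ := le_rfl
  le_trans _ _ _ h₁ h₂ V := (h₁ V).trans (h₂ V)
  le_antisymm _ _ h₁ h₂ := Subfun.ext (funext fun V => le_antisymm (h₁ V) (h₂ V))

/-- The quotient functor `V ↦ F(V) / G(V)`. -/
def quotient (G : Subfun F) : C ⥤ ModuleCat.{w} k where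
  obj V := ModuleCat.of k (F.obj V ⧸ G.carrier V)
  map {V W} f := ModuleCat.ofHom
    ((G.carrier V).mapQ (G.carrier W) (F.map f).hom fun _ hx => G.map_mem f hx)
  map_id V := by
    ext x
    simp
  map_comp f g := by
    ext x
    simp

end Subfun

/-- A family of submodules is homogeneous with respect to a family of decompositions
`F(V) = ⨁ i, d V i` if each of its members is the sum of its intersections with the
homogeneous summands. -/
def IsHomogeneousFamily {X : Type*} {M : X → Type*} [∀ V, AddCommGroup (M V)]
    [∀ V, Module k (M V)] (d : ∀ V, ℕ → Submodule k (M V)) (p : ∀ V, Submodule k (M V)) : Prop :=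
  ∀ V, p V ≤ ⨆ i, p V ⊓ d V i

variable [Preadditive C] [HasFiniteBiproducts C]

/-- The endomorphism `e_i` of `V₁ ⊕ ⋯ ⊕ Vₙ`: the projection that forgets the `i`-th summand,
followed by the canonical inclusion. -/
def forgetSummand {n : ℕ} (V : Fin n → C) (i : Fin n) : (⨁ V) ⟶ ⨁ V :=
  biproduct.toSubtype V (fun j => j ≠ i) ≫ biproduct.fromSubtype V (fun j => j ≠ i)

/-- The reduced part `ker (F(V) → F(0))` of `F(V)`. -/
def reducedPart (F : C ⥤ ModuleCat.{w} k) (V : C) : Submodule k (F.obj V) :=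
  LinearMap.ker (F.map (0 : V ⟶ (0 : C))).hom

/-- The `n`-th cross effect (`n ≥ 1`) of `F`: the elements of the reduced part of
`F(V₁ ⊕ ⋯ ⊕ Vₙ)` that are killed by all the `F(e_i)`. -/
def crossEffect (F : C ⥤ ModuleCat.{w} k) {n : ℕ} (V : Fin n → C) : Submodule k (F.obj (⨁ V)) :=
  reducedPart F (⨁ V) ⊓ ⨅ i, LinearMap.ker (F.map (forgetSummand V i)).hom

/-- `F` is polynomial of Eilenberg–Mac Lane degree less than `n` (`n ≥ 1`): the `n`-th cross
effect vanishes. -/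
def EMLDegreeLT (F : C ⥤ ModuleCat.{w} k) (n : ℕ) : Prop :=
  ∀ V : Fin n → C, crossEffect F V = ⊥

/-- The folding map `V ⊕ ⋯ ⊕ V ⟶ V`. -/
def fold (n : ℕ) (V : C) : (⨁ fun _ : Fin n => V) ⟶ V :=
  biproduct.desc fun _ => 𝟙 V

/-- The `n`-th term (`n ≥ 1`) of the copolynomial filtration of `F`: the image of the composition
`crₙ F(V, …, V) ↪ F(V ⊕ ⋯ ⊕ V) ⟶ F(V)` of the inclusion and of `F` of the folding map. -/
def copolynomial (F : C ⥤ ModuleCat.{w} k) (n : ℕ) : Subfun F where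
  carrier V := (crossEffect F fun _ : Fin n => V).map (F.map (fold n V)).hom
  map_mem := by
    rintro V W f _ ⟨x, hx, rfl⟩
    have hx' := hx
    simp only [crossEffect, reducedPart, SetLike.mem_coe, Submodule.mem_inf, LinearMap.mem_ker,
      Submodule.mem_iInf] at hx'
    obtain ⟨h0, he⟩ := hx'
    refine ⟨(F.map (biproduct.map fun _ => f)).hom x, ?_, ?_⟩
    · simp only [crossEffect, reducedPart, SetLike.mem_coe, Submodule.mem_inf, LinearMap.mem_ker,
        Submodule.mem_iInf]
      refine ⟨?_, fun i => ?_⟩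
      · rw [← LinearMap.comp_apply, ← ModuleCat.hom_comp, ← F.map_comp, comp_zero]
        exact h0
      · have : biproduct.map (fun _ => f) ≫ forgetSummand (fun _ : Fin n => W) i =
            forgetSummand (fun _ : Fin n => V) i ≫ biproduct.map fun _ => f := by
          unfold forgetSummand
          rw [biproduct.toSubtype_fromSubtype, biproduct.toSubtype_fromSubtype]
          ext a
          simp
          split_ifs <;> simp
        rw [← LinearMap.comp_apply, ← ModuleCat.hom_comp, ← F.map_comp, this, F.map_comp,
          ModuleCat.hom_comp, LinearMap.comp_apply, he i, map_zero]
    · rw [← LinearMap.comp_apply, ← ModuleCat.hom_comp, ← F.map_comp,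
        ← LinearMap.comp_apply, ← ModuleCat.hom_comp, ← F.map_comp]
      congr 3
      unfold fold
      ext
      simp

/-- A graded commutative exponential structure on a functor `F` from an additive category to
`k`-modules: a grading of `F` by subfunctors, indexed by the natural numbers, and natural
isomorphisms `F(V) ⊗ F(W) ≃ F(V ⊕ W)` and `k ≃ F(0)` of graded modules which are associative,
unital, and commutative up to the Koszul sign. -/
structure ExponentialStructure (F : C ⥤ ModuleCat.{w} k) where
  /-- the homogeneous summand of degree `i` -/
  deg : ∀ V : C, ℕ → Submodule k (F.obj V)
  deg_isInternal : ∀ V, DirectSum.IsInternal (deg V)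
  deg_map : ∀ {V W : C} (f : V ⟶ W) (i : ℕ) {x : F.obj V}, x ∈ deg V i →
    (F.map f).hom x ∈ deg W i
  φ : ∀ V W : C, (F.obj V ⊗[k] F.obj W) ≃ₗ[k] F.obj (V ⊞ W)
  φ_natural : ∀ {V V' W W' : C} (f : V ⟶ V') (g : W ⟶ W') (x : F.obj V) (y : F.obj W),
    (F.map (biprod.map f g)).hom (φ V W (x ⊗ₜ[k] y)) =
      φ V' W' ((F.map f).hom x ⊗ₜ[k] (F.map g).hom y)
  φ_deg : ∀ {V W : C} {i j : ℕ} {x : F.obj V} {y : F.obj W}, x ∈ deg V i → y ∈ deg W j →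
    φ V W (x ⊗ₜ[k] y) ∈ deg (V ⊞ W) (i + j)
  u : k ≃ₗ[k] F.obj (0 : C)
  u_deg : u 1 ∈ deg (0 : C) 0
  φ_assoc : ∀ {V W X : C} (x : F.obj V) (y : F.obj W) (z : F.obj X),
    (F.map (biprod.associator V W X).hom).hom
        (φ (V ⊞ W) X (φ V W (x ⊗ₜ[k] y) ⊗ₜ[k] z)) =
      φ V (W ⊞ X) (x ⊗ₜ[k] φ W X (y ⊗ₜ[k] z))
  φ_unit_left : ∀ {V : C} (x : F.obj V),
    (F.map (biprod.snd : (0 : C) ⊞ V ⟶ V)).hom (φ 0 V (u 1 ⊗ₜ[k] x)) = x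
  φ_unit_right : ∀ {V : C} (x : F.obj V),
    (F.map (biprod.fst : V ⊞ (0 : C) ⟶ V)).hom (φ V 0 (x ⊗ₜ[k] u 1)) = x
  φ_comm : ∀ {V W : C} {i j : ℕ} {x : F.obj V} {y : F.obj W}, x ∈ deg V i → y ∈ deg W j →
    (F.map (biprod.braiding V W).hom).hom (φ V W (x ⊗ₜ[k] y)) =
      (-1 : k) ^ (i * j) • φ W V (y ⊗ₜ[k] x)

namespace ExponentialStructure

variable {F : C ⥤ ModuleCat.{w} k} (E : ExponentialStructure F)

/-- The multiplication `F(V) ⊗ F(V) ≃ F(V ⊕ V) ⟶ F(V)`, as a bilinear map; the second map is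
`F` of the sum map `V ⊕ V ⟶ V`. -/
def mul (V : C) : F.obj V →ₗ[k] F.obj V →ₗ[k] F.obj V :=
  TensorProduct.curry
    ((F.map (biprod.desc (𝟙 V) (𝟙 V))).hom ∘ₗ (E.φ V V).toLinearMap)

/-- The augmentation `F(V) ⟶ F(0) ≃ k`. -/
def counit (V : C) : F.obj V →ₗ[k] k :=
  E.u.symm.toLinearMap ∘ₗ (F.map (0 : V ⟶ (0 : C))).hom

/-- The augmentation ideal of the algebra `F(V)`. -/
def augIdeal (V : C) : Submodule k (F.obj V) :=
  LinearMap.ker (E.counit V)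

/-- The powers of the augmentation ideal: the zeroth power is the whole algebra, and the power
`n + 1` is spanned by the products of an element of the `n`-th power and an element of the
augmentation ideal. -/
def augIdealPow (V : C) : ℕ → Submodule k (F.obj V)
  | 0 => ⊤
  | n + 1 => Submodule.map₂ (E.mul V) (augIdealPow V n) (E.augIdeal V)

theorem map_mul {V W : C} (f : V ⟶ W) (x y : F.obj V) :
    (F.map f).hom (E.mul V x y) = E.mul W ((F.map f).hom x) ((F.map f).hom y) := by
  simp only [mul, TensorProduct.curry_apply, LinearMap.comp_apply, LinearEquiv.coe_coe]
  rw [← E.φ_natural f f x y, ← LinearMap.comp_apply, ← ModuleCat.hom_comp, ← F.map_comp,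
    ← LinearMap.comp_apply, ← ModuleCat.hom_comp, ← F.map_comp]
  congr 3
  ext <;> simp

theorem map_augIdeal {V W : C} (f : V ⟶ W) {x : F.obj V} (hx : x ∈ E.augIdeal V) :
    (F.map f).hom x ∈ E.augIdeal W := by
  simp only [augIdeal, counit, LinearMap.mem_ker, LinearMap.comp_apply] at hx ⊢
  rw [← LinearMap.comp_apply (F.map 0).hom, ← ModuleCat.hom_comp, ← F.map_comp, comp_zero]
  exact hx

/-- The `n`-th term `V ↦ Ē(V)ⁿ` of the augmentation filtration, the functor of the `n`-th
powers of the augmentation ideals. -/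
def augPow (n : ℕ) : Subfun F where
  carrier V := E.augIdealPow V n
  map_mem := by
    intro V W f
    induction n with
    | zero => intro x _; exact Submodule.mem_top
    | succ n ih =>
      intro x hx
      have : Submodule.map₂ (E.mul V) (E.augIdealPow V n) (E.augIdeal V) ≤
          (Submodule.map₂ (E.mul W) (E.augIdealPow W n) (E.augIdeal W)).comap (F.map f).hom := by
        rw [Submodule.map₂_le]
        intro a ha b hb
        rw [Submodule.mem_comap, E.map_mul]
        exact Submodule.apply_mem_map₂ _ (ih ha) (E.map_augIdeal f hb)
      exact this hx

end ExponentialStructure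

end Ordinary

section Strict

variable (k : Type u) [CommRing k]

/-- The property of being a finitely generated projective module. -/
def isFGProj : ObjectProperty (ModuleCat.{u} k) :=
  fun M => Module.Finite k M ∧ Module.Projective k M

instance : (isFGProj k).IsClosedUnderIsomorphisms where
  of_iso e h := by
    obtain ⟨h₁, h₂⟩ := h
    exact ⟨Module.Finite.equiv e.toLinearEquiv, Module.Projective.of_equiv e.toLinearEquiv⟩

instance : (isFGProj k).IsClosedUnderFiniteProducts where
  isClosedUnderLimitsOfShape J _ := by
    refine ObjectProperty.IsClosedUnderLimitsOfShape.mk' ?_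
    rintro _ ⟨D, hD⟩
    have := Fintype.ofFinite J
    classical
    let f : J → ModuleCat.{u} k := fun j => D.obj ⟨j⟩
    have h₁ : ∀ j, Module.Finite k (f j) := fun j => (hD ⟨j⟩).1
    have h₂ : ∀ j, Module.Projective k (f j) := fun j => (hD ⟨j⟩).2
    have hP : isFGProj k (ModuleCat.of k (∀ j, f j)) :=
      ⟨inferInstanceAs (Module.Finite k (∀ j, f j)),
        Module.Projective.of_equiv (DirectSum.linearEquivFunOnFintype k J fun j => f j)⟩
    exact (isFGProj k).prop_of_iso ((ModuleCat.biproductIsoPi f).symm ≪≫ biproduct.isoProduct f ≪≫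
      (HasLimit.isoOfNatIso Discrete.natIsoFunctor).symm) hP

/-- The category of finitely generated projective `k`-modules. -/
abbrev FGProj := (isFGProj k).FullSubcategory

instance : HasFiniteBiproducts (FGProj k) := HasFiniteBiproducts.of_hasFiniteProducts

variable {k}

/-- The `k`-linear map underlying a morphism of `FGProj k`. -/
abbrev FGProj.lin {V W : FGProj k} (f : V ⟶ W) : V.obj →ₗ[k] W.obj := f.hom.hom

variable (k) in
/-- A strict analytic functor over `k`, that is, a direct sum over `d : ℕ` of homogeneous strict
polynomial functors of weight `d`. The action on morphisms is by polynomial laws, described on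
points: each `S`-linear map `V_S → W_S` (an element of `S ⊗ Hom(V, W)`, as `V` and `W` are finitely
generated and projective), for a commutative `k`-algebra `S`, acts as an `S`-linear map
`F(V)_S → F(W)_S`; this is functorial and compatible with extensions of scalars; and on the
summand of weight `d` the action is homogeneous of degree `d`. -/
structure StrictAnalyticFunctor where
  obj : FGProj k → ModuleCat.{w} k
  map : ∀ (S : Type u) [CommRing S] [Algebra k S] {V W : FGProj k},
    (S ⊗[k] V.obj →ₗ[S] S ⊗[k] W.obj) → (S ⊗[k] obj V →ₗ[S] S ⊗[k] obj W)
  map_id : ∀ (S : Type u) [CommRing S] [Algebra k S] (V : FGProj k),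
    map S (LinearMap.id : S ⊗[k] V.obj →ₗ[S] S ⊗[k] V.obj) = LinearMap.id
  map_comp : ∀ (S : Type u) [CommRing S] [Algebra k S] {V W X : FGProj k}
    (g : S ⊗[k] W.obj →ₗ[S] S ⊗[k] X.obj) (f : S ⊗[k] V.obj →ₗ[S] S ⊗[k] W.obj),
    map S (g ∘ₗ f) = map S g ∘ₗ map S f
  /-- If `f'` is obtained from `f` by extension of scalars along `ψ`, then so is the map induced
  by `f'` from the map induced by `f`. -/
  map_extend : ∀ (S S' : Type u) [CommRing S] [Algebra k S] [CommRing S'] [Algebra k S']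
    (ψ : S →ₐ[k] S') {V W : FGProj k}
    (f : S ⊗[k] V.obj →ₗ[S] S ⊗[k] W.obj) (f' : S' ⊗[k] V.obj →ₗ[S'] S' ⊗[k] W.obj),
    (∀ x, f' (ψ.toLinearMap.rTensor V.obj x) = ψ.toLinearMap.rTensor W.obj (f x)) →
    ∀ y, map S' f' (ψ.toLinearMap.rTensor (obj V) y) = ψ.toLinearMap.rTensor (obj W) (map S f y)
  /-- the homogeneous summand of weight `d` -/
  weight : ∀ V : FGProj k, ℕ → Submodule k (obj V)
  weight_isInternal : ∀ V, DirectSum.IsInternal (weight V)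
  map_weight : ∀ (S : Type u) [CommRing S] [Algebra k S] {V W : FGProj k}
    (f : S ⊗[k] V.obj →ₗ[S] S ⊗[k] W.obj) (d : ℕ) {y : S ⊗[k] obj V},
    y ∈ (weight V d).baseChange S → map S f y ∈ (weight W d).baseChange S
  map_smul : ∀ (S : Type u) [CommRing S] [Algebra k S] {V W : FGProj k} (s : S)
    (f : S ⊗[k] V.obj →ₗ[S] S ⊗[k] W.obj) (d : ℕ) {y : S ⊗[k] obj V},
    y ∈ (weight V d).baseChange S → map S (s • f) y = s ^ d • map S f y

namespace StrictAnalyticFunctor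

variable (F : StrictAnalyticFunctor.{w} k)

/-- The ordinary functor underlying a strict analytic functor: the action of the `k`-points. -/
abbrev toFunctor : FGProj k ⥤ ModuleCat.{w} k where
  obj := F.obj
  map {V W} f := ModuleCat.ofHom
    ((TensorProduct.lid k (F.obj W)).toLinearMap ∘ₗ
      F.map k ((FGProj.lin f).baseChange k) ∘ₗ (TensorProduct.lid k (F.obj V)).symm.toLinearMap)
  map_id V := by
    have h : (FGProj.lin (𝟙 V)).baseChange k = LinearMap.id := LinearMap.baseChange_id
    rw [h, F.map_id]
    ext x
    simp
  map_comp {V W X} f g := by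
    have h : (FGProj.lin (f ≫ g)).baseChange k =
        (FGProj.lin g).baseChange k ∘ₗ (FGProj.lin f).baseChange k :=
      LinearMap.baseChange_comp _ _
    rw [h, F.map_comp]
    ext x
    simp

/-- A family of submodules of the `F(V)` is a strict analytic subfunctor of `F`: it is
homogeneous for the weights and stable under the polynomial action of the morphisms. -/
def IsStrictSubfunctor (p : ∀ V : FGProj k, Submodule k (F.obj V)) : Prop :=
  IsHomogeneousFamily F.weight p ∧
  ∀ (S : Type u) [CommRing S] [Algebra k S] {V W : FGProj k}
    (f : S ⊗[k] V.obj →ₗ[S] S ⊗[k] W.obj) {y : S ⊗[k] F.obj V},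
    y ∈ (p V).baseChange S → F.map S f y ∈ (p W).baseChange S

end StrictAnalyticFunctor

/-- The map `f ⊕ g` from `(V ⊕ W)_S` to `(V' ⊕ W')_S`. -/
def sumMap (S : Type u) [CommRing S] [Algebra k S] {V V' W W' : FGProj k}
    (f : S ⊗[k] V.obj →ₗ[S] S ⊗[k] V'.obj) (g : S ⊗[k] W.obj →ₗ[S] S ⊗[k] W'.obj) :
    S ⊗[k] (V ⊞ W).obj →ₗ[S] S ⊗[k] (V' ⊞ W').obj :=
  (FGProj.lin (biprod.inl : V' ⟶ V' ⊞ W')).baseChange S ∘ₗ f ∘ₗ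
      (FGProj.lin (biprod.fst : V ⊞ W ⟶ V)).baseChange S +
    (FGProj.lin (biprod.inr : W' ⟶ V' ⊞ W')).baseChange S ∘ₗ g ∘ₗ
      (FGProj.lin (biprod.snd : V ⊞ W ⟶ W)).baseChange S

/-- A graded commutative strict exponential structure on a strict analytic functor `F`: an
exponential structure on the underlying functor such that the grading is by strict analytic
subfunctors and the isomorphisms `F(V) ⊗ F(W) ≃ F(V ⊕ W)` and `k ≃ F(0)` are morphisms of strict
analytic (bi)functors: they preserve the weights and commute with the polynomial actions. -/
structure StrictExponentialStructure (F : StrictAnalyticFunctor.{w} k) extends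
    ExponentialStructure F.toFunctor where
  deg_strict : ∀ i : ℕ, F.IsStrictSubfunctor fun V => deg V i
  φ_weight : ∀ {V W : FGProj k} {a b : ℕ} {x : F.obj V} {y : F.obj W},
    x ∈ F.weight V a → y ∈ F.weight W b → φ V W (x ⊗ₜ[k] y) ∈ F.weight (V ⊞ W) (a + b)
  u_weight : u 1 ∈ F.weight (0 : FGProj k) 0
  φ_strict : ∀ (S : Type u) [CommRing S] [Algebra k S] {V V' W W' : FGProj k}
    (f : S ⊗[k] V.obj →ₗ[S] S ⊗[k] V'.obj) (g : S ⊗[k] W.obj →ₗ[S] S ⊗[k] W'.obj)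
    (z : (S ⊗[k] F.obj V) ⊗[S] (S ⊗[k] F.obj W)),
    F.map S (sumMap S f g) ((φ V W).toLinearMap.baseChange S
        ((TensorProduct.AlgebraTensorModule.distribBaseChange k S (F.obj V) (F.obj W)).symm z)) =
      (φ V' W').toLinearMap.baseChange S
        ((TensorProduct.AlgebraTensorModule.distribBaseChange k S (F.obj V') (F.obj W')).symm
          (TensorProduct.map (F.map S f) (F.map S g) z))

end Strict

end ExpFun

end

/-! The augmentation power is identified outright with the copolynomial filtration, which is defined
without the exponential structure; everything else is then a fact about arbitrary functors.

For any `F` and `n > 0`, the commuting idempotents `F(e_i)` give the projector `∏ (1 - F(e_i))` onto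
the cross effect. This projector is natural, so cross effects pass to quotients: `crₙ(F/G)` is the
image of `crₙ F`. Hence `F/G` has degree `< n` exactly when `copolynomial F n ≤ G`
(`EMLDegreeLT_quotient_of_copolynomial_le`, `copolynomial_le_of_EMLDegreeLT_quotient`). Natural
endomorphisms preserve `copolynomial F n`, so it is homogeneous for any grading by subfunctors.

For exponential `F` (`augPow_eq_copolynomial`), `F(V₁ ⊕ ⋯ ⊕ Vₙ)` is spanned by products `x₁ ⋯ xₙ`
with each `xᵢ` coming from `F(Vᵢ)` and either equal to 1 or in the augmentation ideal. The projector
fixes such a product if no factor is 1 and kills it otherwise, and folding turns the surviving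
products into n-fold products in the augmentation ideal of `F(V)`.

In the strict setting, the map `F(V ⊕ ⋯ ⊕ V) → F(V)` with image `copolynomial` also commutes with
the polynomial actions (`map_fold_crossProj`). -/

noncomputable section

namespace ExpFun

/-! ### Cross effects and the copolynomial filtration of an arbitrary functor -/

section General

variable {k : Type u} [CommRing k]

theorem mul_prod_one_sub_eq_zero {A ι : Type*} [Ring A] (a : ι → A) (hi : ∀ i, a i * a i = a i)
    (hc : ∀ i j, a i * a j = a j * a i) (l : List ι) {i : ι} (h : i ∈ l) :
    a i * (l.map fun j => 1 - a j).prod = 0 := by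
  induction l with
  | nil => simp at h
  | cons j l ih =>
    rw [List.map_cons, List.prod_cons]
    rcases List.mem_cons.1 h with rfl | h
    · rw [← mul_assoc, mul_sub, hi, mul_one, sub_self, zero_mul]
    · rw [← mul_assoc, mul_sub, mul_one, hc, ← one_sub_mul, mul_assoc, ih h, mul_zero]

theorem prod_one_sub_mul_eq_zero {A ι : Type*} [Ring A] (a : ι → A) (hi : ∀ i, a i * a i = a i)
    (hc : ∀ i j, a i * a j = a j * a i) (l : List ι) {i : ι} (h : i ∈ l) :
    (l.map fun j => 1 - a j).prod * a i = 0 := by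
  have : Commute (l.map fun j => 1 - a j).prod (a i) := by
    apply Commute.list_prod_left
    intro x hx
    obtain ⟨j, -, rfl⟩ := List.mem_map.1 hx
    exact (Commute.one_left _).sub_left (hc j i)
  rw [this.eq, mul_prod_one_sub_eq_zero a hi hc l h]

theorem prod_one_sub_apply {M ι : Type*} [AddCommGroup M] [Module k M] (a : ι → Module.End k M)
    (l : List ι) {x : M} (h : ∀ i ∈ l, a i x = 0) : (l.map fun j => 1 - a j).prod x = x := by
  induction l with
  | nil => simp
  | cons j l ih =>
    rw [List.map_cons, List.prod_cons, Module.End.mul_apply,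
      ih fun i hi => h i (List.mem_cons_of_mem _ hi), LinearMap.sub_apply,
      h j List.mem_cons_self, sub_zero, Module.End.one_apply]

/-- Gives the naturality of the cross-effect projector, both along `F → F/G` and along the
polynomial actions over a `k`-algebra. -/
theorem prod_one_sub_intertwine {M N ι : Type*} [AddCommGroup M] [Module k M] [AddCommGroup N]
    [Module k N] (a : ι → Module.End k M) (b : ι → Module.End k N) (f : M →ₗ[k] N)
    (h : ∀ i x, f (a i x) = b i (f x)) (l : List ι) (x : M) :
    f ((l.map fun j => 1 - a j).prod x) = (l.map fun j => 1 - b j).prod (f x) := by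
  induction l generalizing x with
  | nil => simp
  | cons j l ih =>
    simp only [List.map_cons, List.prod_cons, Module.End.mul_apply, LinearMap.sub_apply,
      Module.End.one_apply, map_sub, ih, h]

variable {C : Type u₁} [Category.{v} C]

theorem map_map_hom (F : C ⥤ ModuleCat.{w} k) {V W X : C} (f : V ⟶ W) (g : W ⟶ X) (x : F.obj V) :
    (F.map g).hom ((F.map f).hom x) = (F.map (f ≫ g)).hom x := by
  rw [F.map_comp, ModuleCat.hom_comp, LinearMap.comp_apply]

theorem map_id_hom (F : C ⥤ ModuleCat.{w} k) {V : C} (x : F.obj V) :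
    (F.map (𝟙 V)).hom x = x := by
  rw [F.map_id, ModuleCat.hom_id, LinearMap.id_apply]

namespace Subfun

variable {F : C ⥤ ModuleCat.{w} k} (G : Subfun F)

/-- The projection `F(V) ⟶ F(V) / G(V)`. -/
def proj (V : C) : F.obj V →ₗ[k] G.quotient.obj V :=
  (G.carrier V).mkQ

theorem proj_surjective {V : C} : Function.Surjective (G.proj V) :=
  (G.carrier V).mkQ_surjective

theorem proj_eq_zero_iff {V : C} (x : F.obj V) : G.proj V x = 0 ↔ x ∈ G.carrier V :=
  Submodule.Quotient.mk_eq_zero _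

theorem quotient_map_proj {V W : C} (f : V ⟶ W) (x : F.obj V) :
    (G.quotient.map f).hom (G.proj V x) = G.proj W ((F.map f).hom x) := rfl

end Subfun

variable [Preadditive C] [HasFiniteBiproducts C]

theorem ι_forgetSummand {n : ℕ} (V : Fin n → C) (i j : Fin n) :
    biproduct.ι V j ≫ forgetSummand V i = if j = i then 0 else biproduct.ι V j := by
  unfold forgetSummand
  rw [biproduct.toSubtype_fromSubtype]
  apply biproduct.hom_ext
  intro a
  by_cases h' : j = a
  · subst h'
    by_cases h : j = i <;> simp [h]
  · by_cases h : j = i <;> simp [h, biproduct.ι_π_ne _ h']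

theorem ι_forgetSummand_assoc {n : ℕ} (V : Fin n → C) (i j : Fin n) {W : C} (g : (⨁ V) ⟶ W) :
    biproduct.ι V j ≫ forgetSummand V i ≫ g = (if j = i then 0 else biproduct.ι V j) ≫ g := by
  rw [← Category.assoc, ι_forgetSummand]

theorem forgetSummand_comm {n : ℕ} (V : Fin n → C) (i j : Fin n) :
    forgetSummand V i ≫ forgetSummand V j = forgetSummand V j ≫ forgetSummand V i := by
  apply biproduct.hom_ext'
  intro a
  rw [ι_forgetSummand_assoc, ι_forgetSummand_assoc]
  split_ifs <;> simp [ι_forgetSummand, *]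

theorem forgetSummand_idem {n : ℕ} (V : Fin n → C) (i : Fin n) :
    forgetSummand V i ≫ forgetSummand V i = forgetSummand V i := by
  apply biproduct.hom_ext'
  intro a
  rw [ι_forgetSummand_assoc, ι_forgetSummand]
  split_ifs <;> simp [ι_forgetSummand, *]

theorem map_comp_forgetSummand {n : ℕ} {V W : Fin n → C} (f : ∀ i, V i ⟶ W i) (i : Fin n) :
    biproduct.map f ≫ forgetSummand W i = forgetSummand V i ≫ biproduct.map f := by
  apply biproduct.hom_ext'
  intro a
  rw [ι_forgetSummand_assoc, biproduct.ι_map_assoc, ι_forgetSummand]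
  split_ifs <;> simp

/-- The action of `F` on the `i`-th forgetful endomorphism of `V₁ ⊕ ⋯ ⊕ Vₙ`. -/
def forgetEnd (F : C ⥤ ModuleCat.{w} k) {n : ℕ} (V : Fin n → C) (i : Fin n) :
    Module.End k (F.obj (⨁ V)) :=
  (F.map (forgetSummand V i)).hom

/-- The projection of `F(V₁ ⊕ ⋯ ⊕ Vₙ)` onto the cross effect. -/
def crossProj (F : C ⥤ ModuleCat.{w} k) {n : ℕ} (V : Fin n → C) : Module.End k (F.obj (⨁ V)) :=
  ((List.finRange n).map fun i => 1 - forgetEnd F V i).prod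

variable (F : C ⥤ ModuleCat.{w} k)

theorem forgetEnd_idem {n : ℕ} (V : Fin n → C) (i : Fin n) :
    forgetEnd F V i * forgetEnd F V i = forgetEnd F V i := by
  refine LinearMap.ext fun x => ?_
  rw [Module.End.mul_apply, forgetEnd, map_map_hom, forgetSummand_idem]

theorem forgetEnd_comm {n : ℕ} (V : Fin n → C) (i j : Fin n) :
    forgetEnd F V i * forgetEnd F V j = forgetEnd F V j * forgetEnd F V i := by
  refine LinearMap.ext fun x => ?_
  simp only [Module.End.mul_apply, forgetEnd]
  rw [map_map_hom, map_map_hom, forgetSummand_comm]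

/-- The zero map factors through `e_0` once `n > 0`, so being killed by the `F(e_i)` already forces
reducedness. -/
theorem mem_crossEffect_iff {n : ℕ} (hn : 0 < n) (V : Fin n → C) (x : F.obj (⨁ V)) :
    x ∈ crossEffect F V ↔ ∀ i, (F.map (forgetSummand V i)).hom x = 0 := by
  simp only [crossEffect, reducedPart, Submodule.mem_inf, LinearMap.mem_ker, Submodule.mem_iInf]
  refine ⟨fun h => h.2, fun h => ⟨?_, h⟩⟩
  have : (0 : (⨁ V) ⟶ (0 : C)) = forgetSummand V ⟨0, hn⟩ ≫ 0 := by simp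
  rw [this, ← map_map_hom, h, map_zero]

theorem crossProj_mem {n : ℕ} (hn : 0 < n) (V : Fin n → C) (x : F.obj (⨁ V)) :
    crossProj F V x ∈ crossEffect F V := by
  rw [mem_crossEffect_iff F hn]
  intro i
  exact LinearMap.congr_fun (mul_prod_one_sub_eq_zero (forgetEnd F V) (forgetEnd_idem F V)
    (forgetEnd_comm F V) (List.finRange n) (List.mem_finRange i)) x

theorem crossProj_eq_self {n : ℕ} (hn : 0 < n) (V : Fin n → C) {x : F.obj (⨁ V)}
    (hx : x ∈ crossEffect F V) : crossProj F V x = x := by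
  rw [mem_crossEffect_iff F hn] at hx
  exact prod_one_sub_apply _ _ fun i _ => hx i

theorem crossProj_eq_zero {n : ℕ} (V : Fin n → C) (i : Fin n) {x : F.obj (⨁ V)}
    (hx : (F.map (forgetSummand V i)).hom x = x) : crossProj F V x = 0 := by
  rw [← hx]
  exact LinearMap.congr_fun (prod_one_sub_mul_eq_zero (forgetEnd F V) (forgetEnd_idem F V)
    (forgetEnd_comm F V) (List.finRange n) (List.mem_finRange i)) x

/-- Replaces an intersection of kernels by the range of one linear map, a form that can be tested on
generators after extension of scalars. -/
theorem copolynomial_carrier {n : ℕ} (hn : 0 < n) (V : C) :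
    (copolynomial F n).carrier V =
      LinearMap.range ((F.map (fold n V)).hom ∘ₗ crossProj F fun _ : Fin n => V) := by
  apply le_antisymm
  · rintro _ ⟨x, hx, rfl⟩
    exact ⟨x, by rw [LinearMap.comp_apply, crossProj_eq_self F hn _ hx]⟩
  · rintro _ ⟨x, rfl⟩
    exact ⟨_, crossProj_mem F hn _ x, rfl⟩

/-- Passes from distinct `V i` to equal arguments: embed each `V i` in `⨁ V`; folding the copies of
`⨁ V` then gives back the identity. -/
theorem crossEffect_le_copolynomial {n : ℕ} (hn : 0 < n) (V : Fin n → C) :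
    crossEffect F V ≤ (copolynomial F n).carrier (⨁ V) := by
  intro x hx
  rw [mem_crossEffect_iff F hn] at hx
  refine ⟨(F.map (biproduct.map fun i => biproduct.ι V i)).hom x, ?_, ?_⟩
  · refine (mem_crossEffect_iff F hn _ _).2 fun i => ?_
    rw [map_map_hom, map_comp_forgetSummand, ← map_map_hom, hx, map_zero]
  · rw [map_map_hom]
    have : (biproduct.map fun i => biproduct.ι V i) ≫ fold n (⨁ V) = 𝟙 _ := by
      apply biproduct.hom_ext'
      intro i
      simp [fold]
    rw [this, map_id_hom]

variable {F}

/-- An element of the cross effect of the quotient is its own projection, hence the class of the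
projection of any lift, which lies in `crossEffect F V`. -/
theorem EMLDegreeLT_quotient_of_copolynomial_le {n : ℕ} (hn : 0 < n) (G : Subfun F)
    (h : copolynomial F n ≤ G) : EMLDegreeLT G.quotient n := by
  intro V
  rw [eq_bot_iff]
  intro y hy
  obtain ⟨x, rfl⟩ := G.proj_surjective y
  have e : crossProj G.quotient V (G.proj (⨁ V) x) = G.proj (⨁ V) (crossProj F V x) :=
    (prod_one_sub_intertwine (forgetEnd F V) (forgetEnd G.quotient V) (G.proj (⨁ V))
      (fun _ _ => rfl) _ x).symm
  rw [Submodule.mem_bot, ← crossProj_eq_self _ hn V hy, e, G.proj_eq_zero_iff]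
  exact h _ (crossEffect_le_copolynomial F hn V (crossProj_mem F hn V x))

theorem copolynomial_le_of_EMLDegreeLT_quotient {n : ℕ} (hn : 0 < n) (G : Subfun F)
    (h : EMLDegreeLT G.quotient n) : copolynomial F n ≤ G := by
  rintro V _ ⟨x, hx, rfl⟩
  apply G.map_mem
  rw [SetLike.mem_coe, mem_crossEffect_iff F hn] at hx
  have hq : G.proj _ x ∈ crossEffect G.quotient fun _ : Fin n => V := by
    rw [mem_crossEffect_iff _ hn]
    intro i
    rw [G.quotient_map_proj, hx, map_zero]
  rwa [h, Submodule.mem_bot, G.proj_eq_zero_iff] at hq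

theorem copolynomial_map_mem {n : ℕ} (hn : 0 < n) (π : ∀ V : C, F.obj V →ₗ[k] F.obj V)
    (hπ : ∀ {V W : C} (f : V ⟶ W) (x : F.obj V), π W ((F.map f).hom x) = (F.map f).hom (π V x))
    {V : C} {x : F.obj V} (hx : x ∈ (copolynomial F n).carrier V) :
    π V x ∈ (copolynomial F n).carrier V := by
  obtain ⟨y, hy, rfl⟩ := hx
  refine ⟨π _ y, ?_, (hπ _ _).symm⟩
  rw [SetLike.mem_coe, mem_crossEffect_iff F hn] at hy ⊢
  intro i
  rw [← hπ, hy, map_zero]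

/-- The projections onto the graded pieces are natural endomorphisms of `F`, so they preserve the
filtration. Applied both to degrees and to weights. -/
theorem isHomogeneousFamily_copolynomial {n : ℕ} (hn : 0 < n)
    (d : ∀ V : C, ℕ → Submodule k (F.obj V)) (hd : ∀ V, DirectSum.IsInternal (d V))
    (hm : ∀ {V W : C} (f : V ⟶ W) (i : ℕ) {x : F.obj V}, x ∈ d V i → (F.map f).hom x ∈ d W i) :
    IsHomogeneousFamily d (copolynomial F n).carrier := by
  classical
  intro V x hx
  let _ : ∀ V, DirectSum.Decomposition (d V) := fun V => (hd V).chooseDecomposition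
  let π : ℕ → ∀ V : C, F.obj V →ₗ[k] F.obj V := fun i V =>
    (d V i).subtype ∘ₗ DirectSum.component k ℕ (fun i => d V i) i ∘ₗ
      (DirectSum.decomposeLinearEquiv (d V)).toLinearMap
  have hπ_apply (i : ℕ) (V : C) (x : F.obj V) : π i V x = DirectSum.decompose (d V) x i := rfl
  have hπ (i : ℕ) {V W : C} (f : V ⟶ W) (x : F.obj V) :
      π i W ((F.map f).hom x) = (F.map f).hom (π i V x) := by
    induction x using DirectSum.Decomposition.inductionOn (d V) with
    | zero => simp only [map_zero]
    | @homogeneous j m =>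
      rw [hπ_apply, hπ_apply]
      by_cases hij : j = i
      · subst hij
        rw [DirectSum.decompose_of_mem_same _ (hm f j m.2),
          DirectSum.decompose_of_mem_same _ m.2]
      · rw [DirectSum.decompose_of_mem_ne _ (hm f j m.2) hij,
          DirectSum.decompose_of_mem_ne _ m.2 hij, map_zero]
    | add x y hx hy => simp only [map_add, hx, hy]
  rw [← DirectSum.sum_support_decompose (d V) x]
  exact Submodule.sum_mem _ fun i _ => Submodule.mem_iSup_of_mem i
    ⟨copolynomial_map_mem hn (π i) (hπ i) hx, SetLike.coe_mem _⟩

end General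

/-! ### Exponential functors: augmentation powers equal the copolynomial filtration -/

namespace ExponentialStructure

variable {k : Type u} [CommRing k] {C : Type u₁} [Category.{v} C] [Preadditive C]
  [HasFiniteBiproducts C] {F : C ⥤ ModuleCat.{w} k} (E : ExponentialStructure F)

/-- The unit of the algebra `F(V)`. -/
def one (V : C) : F.obj V :=
  (F.map (0 : (0 : C) ⟶ V)).hom (E.u 1)

theorem map_one {V W : C} (f : V ⟶ W) : (F.map f).hom (E.one V) = E.one W := by
  rw [one, map_map_hom, zero_comp, one]

theorem mul_apply {V : C} (x y : F.obj V) :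
    E.mul V x y = (F.map (biprod.desc (𝟙 V) (𝟙 V))).hom (E.φ V V (x ⊗ₜ[k] y)) := rfl

theorem one_mul {V : C} (x : F.obj V) : E.mul V (E.one V) x = x := by
  conv_lhs => rw [← map_id_hom F x]
  rw [mul_apply, one, ← E.φ_natural, map_map_hom]
  have : biprod.map (0 : (0 : C) ⟶ V) (𝟙 V) ≫ biprod.desc (𝟙 V) (𝟙 V) = biprod.snd := by
    ext
    simp
  rw [this, E.φ_unit_left]

theorem φ_eq_mul {V W : C} (x : F.obj V) (y : F.obj W) :
    E.φ V W (x ⊗ₜ[k] y) = E.mul (V ⊞ W) ((F.map biprod.inl).hom x) ((F.map biprod.inr).hom y) := by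
  rw [mul_apply, ← E.φ_natural, map_map_hom]
  have : biprod.map (biprod.inl : V ⟶ V ⊞ W) biprod.inr ≫ biprod.desc (𝟙 _) (𝟙 _) = 𝟙 _ := by
    ext <;> simp
  rw [this, map_id_hom]

theorem mem_augIdeal_iff {V : C} (x : F.obj V) :
    x ∈ E.augIdeal V ↔ (F.map (0 : V ⟶ (0 : C))).hom x = 0 := by
  simp [augIdeal, counit]

theorem map_zero_of_mem_augIdeal {V : C} (W : C) {x : F.obj V} (hx : x ∈ E.augIdeal V) :
    (F.map (0 : V ⟶ W)).hom x = 0 := by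
  rw [mem_augIdeal_iff] at hx
  rw [← zero_comp (X := V) (Y := (0 : C)) (f := (0 : (0 : C) ⟶ W)), ← map_map_hom, hx, map_zero]

theorem mul_mem_augIdeal {V : C} (x : F.obj V) {y : F.obj V} (hy : y ∈ E.augIdeal V) :
    E.mul V x y ∈ E.augIdeal V := by
  rw [mem_augIdeal_iff] at hy ⊢
  rw [E.map_mul, hy, map_zero]

theorem span_one_or_mem_augIdeal (V : C) :
    Submodule.span k {x | x = E.one V ∨ x ∈ E.augIdeal V} = ⊤ := by
  rw [eq_top_iff]
  intro x _
  set c := E.counit V x with hc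
  have h : x - c • E.one V ∈ E.augIdeal V := by
    rw [mem_augIdeal_iff, map_sub, map_smul, E.map_one, one]
    have : (F.map (0 : (0 : C) ⟶ 0)).hom (E.u 1) = E.u 1 := by
      rw [← id_zero, map_id_hom]
    rw [this, ← map_smul, smul_eq_mul, mul_one, hc, counit, LinearMap.comp_apply,
      LinearEquiv.coe_coe, LinearEquiv.apply_symm_apply, sub_self]
  rw [← sub_add_cancel x (c • E.one V)]
  exact add_mem (Submodule.subset_span (Or.inr h))
    (Submodule.smul_mem _ _ (Submodule.subset_span (Or.inl rfl)))

/-- The left-bracketed product of a finite sequence of elements of the algebra `F(V)`. -/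
def finProd (V : C) : ∀ {n : ℕ}, (Fin n → F.obj V) → F.obj V
  | 0, _ => E.one V
  | _ + 1, x => E.mul V (finProd V fun i => x i.castSucc) (x (Fin.last _))

theorem finProd_succ (V : C) {n : ℕ} (x : Fin (n + 1) → F.obj V) :
    E.finProd V x = E.mul V (E.finProd V fun i => x i.castSucc) (x (Fin.last _)) := rfl

theorem map_finProd {V W : C} (f : V ⟶ W) {n : ℕ} (x : Fin n → F.obj V) :
    (F.map f).hom (E.finProd V x) = E.finProd W fun i => (F.map f).hom (x i) := by
  induction n with
  | zero => exact E.map_one f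
  | succ n ih => rw [finProd_succ, E.map_mul, ih, finProd_succ]

theorem finProd_eq_zero {V : C} {n : ℕ} {x : Fin n → F.obj V} {i : Fin n} (h : x i = 0) :
    E.finProd V x = 0 := by
  induction n with
  | zero => exact i.elim0
  | succ n ih =>
    rw [finProd_succ]
    induction i using Fin.lastCases with
    | last => rw [h, map_zero]
    | cast i => rw [ih (i := i) h, LinearMap.map_zero₂]

theorem finProd_mem_augIdealPow {V : C} {n : ℕ} {x : Fin n → F.obj V}
    (h : ∀ i, x i ∈ E.augIdeal V) : E.finProd V x ∈ E.augIdealPow V n := by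
  induction n with
  | zero => exact Submodule.mem_top
  | succ n ih => exact Submodule.apply_mem_map₂ _ (ih fun i => h _) (h _)

theorem augIdealPow_le_span {n : ℕ} (hn : 0 < n) (V : C) :
    E.augIdealPow V n ≤
      Submodule.span k {y | ∃ x : Fin n → F.obj V, (∀ i, x i ∈ E.augIdeal V) ∧
        E.finProd V x = y} := by
  induction n, hn using Nat.le_induction with
  | base =>
    -- The first power is built as `F(V) · Ē(V)`, since the zeroth power is the whole algebra; as
    -- `Ē(V)` is an ideal, `x y` itself serves as the single factor.
    refine Submodule.map₂_le.2 fun x _ y hy => Submodule.subset_span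
      ⟨fun _ => E.mul V x y, fun _ => E.mul_mem_augIdeal x hy, ?_⟩
    exact E.one_mul _
  | succ n hn ih =>
    refine (Submodule.map₂_le_map₂_left ih).trans ?_
    rw [← Submodule.span_eq (E.augIdeal V), Submodule.map₂_span_span, Submodule.span_le]
    rintro _ ⟨_, ⟨x, hx, rfl⟩, y, hy, rfl⟩
    refine Submodule.subset_span ⟨Fin.snoc x y, fun i => ?_, ?_⟩
    · rw [Submodule.span_eq]
      induction i using Fin.lastCases with
      | last => simpa using hy
      | cast i => simpa using hx i
    · simp [finProd_succ]

/-- Lift `x₁ ⋯ xₙ` by placing each `xᵢ` in its own summand: `F(e_i)` kills the `i`-th factor, and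
folding recovers the product. -/
theorem augPow_le_copolynomial {n : ℕ} (hn : 0 < n) : E.augPow n ≤ copolynomial F n := by
  intro V
  refine (E.augIdealPow_le_span hn V).trans (Submodule.span_le.2 ?_)
  rintro _ ⟨x, hx, rfl⟩
  refine ⟨E.finProd _ fun i => (F.map (biproduct.ι (fun _ : Fin n => V) i)).hom (x i), ?_, ?_⟩
  · rw [SetLike.mem_coe, mem_crossEffect_iff F hn]
    intro i
    rw [map_finProd]
    refine E.finProd_eq_zero (i := i) ?_
    rw [map_map_hom, ι_forgetSummand, if_pos rfl, E.map_zero_of_mem_augIdeal _ (hx i)]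
  · rw [map_finProd]
    simp [map_map_hom, fold]

/-- `F(V₁ ⊕ ⋯ ⊕ Vₙ)` is spanned by the products of elements that come from the `F(Vⱼ)` and are
either the unit or in the augmentation ideal. -/
theorem map_mem_span_finProd {n : ℕ} (V : Fin n → C) {W : C} (g : (⨁ V) ⟶ W)
    (y : F.obj (⨁ V)) :
    (F.map g).hom y ∈ Submodule.span k {z | ∃ x : ∀ i, F.obj (V i),
      (∀ i, x i = E.one (V i) ∨ x i ∈ E.augIdeal (V i)) ∧
      E.finProd W (fun i => (F.map (biproduct.ι V i ≫ g)).hom (x i)) = z} := by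
  induction n generalizing W with
  | zero =>
    -- An empty biproduct is zero, so the value comes from `F(0)`, which is spanned by `u 1`.
    have : g = (0 : (⨁ V) ⟶ (0 : C)) ≫ 0 := by
      apply biproduct.hom_ext'
      intro i
      exact i.elim0
    rw [this, ← map_map_hom]
    obtain ⟨c, hc⟩ := E.u.surjective ((F.map (0 : (⨁ V) ⟶ (0 : C))).hom y)
    rw [← hc, ← mul_one c, ← smul_eq_mul, map_smul, map_smul]
    exact Submodule.smul_mem _ _ (Submodule.subset_span
      ⟨fun i => i.elim0, fun i => i.elim0, rfl⟩)
  | succ n ih =>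
    let V' : Fin n → C := fun i => V i.castSucc
    let p : (⨁ V) ⟶ (⨁ V') ⊞ V (Fin.last n) :=
      biprod.lift (biproduct.lift fun i => biproduct.π V i.castSucc) (biproduct.π V (Fin.last n))
    let q : (⨁ V') ⊞ V (Fin.last n) ⟶ ⨁ V :=
      biprod.desc (biproduct.desc fun i => biproduct.ι V i.castSucc) (biproduct.ι V (Fin.last n))
    have hpq : p ≫ q = 𝟙 _ := by
      simp only [p, q, biprod.lift_desc, biproduct.lift_desc]
      rw [← biproduct.total, Fin.sum_univ_castSucc]
    obtain ⟨t, ht⟩ := (E.φ _ _).surjective ((F.map p).hom y)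
    have hy : (F.map g).hom y = (F.map (q ≫ g)).hom (E.φ _ _ t) := by
      rw [ht, map_map_hom, reassoc_of% hpq]
    rw [hy]
    clear hy ht y
    induction t using TensorProduct.induction_on with
    | zero => simp only [map_zero, Submodule.zero_mem]
    | add s t hs ht => simpa only [map_add] using add_mem hs ht
    | tmul x y =>
      rw [φ_eq_mul, E.map_mul, map_map_hom, map_map_hom]
      -- The arbitrary target `W` is needed here: the first `n` summands are mapped straight into
      -- it.
      have hx := ih V' (biprod.inl ≫ q ≫ g) x
      have hy : (F.map (biprod.inr ≫ q ≫ g)).hom y ∈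
          (Submodule.span k {x | x = E.one (V (Fin.last n)) ∨ x ∈ E.augIdeal (V (Fin.last n))}).map
            (F.map (biprod.inr ≫ q ≫ g)).hom := by
        rw [span_one_or_mem_augIdeal]
        exact ⟨y, trivial, rfl⟩
      rw [Submodule.map_span] at hy
      have := Submodule.apply_mem_map₂ (E.mul W) hx hy
      rw [Submodule.map₂_span_span] at this
      refine Submodule.span_mono ?_ this
      rintro _ ⟨_, ⟨x, hx, rfl⟩, _, ⟨y, hy, rfl⟩, rfl⟩
      refine ⟨Fin.lastCases y x, fun i => ?_, ?_⟩
      · induction i using Fin.lastCases with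
        | last => simpa using hy
        | cast i => simpa using hx i
      · simp [finProd_succ, q, V']

/-- Enough to project and fold the spanning products, according to whether every factor lies in the
augmentation ideal. -/
theorem copolynomial_le_augPow {n : ℕ} (hn : 0 < n) : copolynomial F n ≤ E.augPow n := by
  intro V
  rw [copolynomial_carrier F hn]
  rintro _ ⟨y, rfl⟩
  have hy := E.map_mem_span_finProd (fun _ : Fin n => V) (𝟙 _) y
  rw [map_id_hom] at hy
  refine (Submodule.span_le (p := ((E.augPow n).carrier V).comap
    ((F.map (fold n V)).hom ∘ₗ crossProj F fun _ : Fin n => V))).2 ?_ hy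
  rintro _ ⟨x, hx, rfl⟩
  rw [SetLike.mem_coe, Submodule.mem_comap, LinearMap.comp_apply]
  by_cases h : ∀ i, x i ∈ E.augIdeal V
  · rw [crossProj_eq_self F hn, map_finProd]
    · simp only [map_map_hom, fold, Category.comp_id, biproduct.ι_desc, map_id_hom]
      exact E.finProd_mem_augIdealPow h
    · rw [mem_crossEffect_iff F hn]
      intro i
      rw [map_finProd]
      refine E.finProd_eq_zero (i := i) ?_
      rw [map_map_hom, Category.comp_id, ι_forgetSummand, if_pos rfl,
        E.map_zero_of_mem_augIdeal _ (h i)]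
  · push Not at h
    obtain ⟨i, hi⟩ := h
    -- Here the `i`-th factor is 1, so `F(e_i)` fixes the whole product and the projector
    -- annihilates it.
    rw [crossProj_eq_zero F _ i, map_zero]
    · exact Submodule.zero_mem _
    · rw [map_finProd]
      congr 1
      ext j
      rw [map_map_hom, Category.comp_id, ι_forgetSummand]
      split_ifs with hj
      · subst hj
        rw [(hx j).resolve_right hi, E.map_one, E.map_one]
      · rfl

theorem augPow_eq_copolynomial {n : ℕ} (hn : 0 < n) : E.augPow n = copolynomial F n :=
  le_antisymm (E.augPow_le_copolynomial hn) (E.copolynomial_le_augPow hn)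

end ExponentialStructure

/-! ### Strict analytic functors: compatibility with the polynomial actions -/

namespace StrictAnalyticFunctor

variable {k : Type u} [CommRing k] (F : StrictAnalyticFunctor.{w} k)
  (S : Type u) [CommRing S] [Algebra k S]

/-- The action of the scalar extension of a `k`-linear map is the scalar extension of the action
of this map. -/
theorem map_baseChange {V W : FGProj k} (f : V ⟶ W) :
    F.map S ((FGProj.lin f).baseChange S) = (F.toFunctor.map f).hom.baseChange S := by
  apply TensorProduct.AlgebraTensorModule.curry_injective
  refine LinearMap.ext_ring (LinearMap.ext fun x => ?_)
  -- Both sides are `S`-linear, so elements `1 ⊗ x` suffice; there the claim is compatibility with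
  -- the structure map `k → S`.
  have h := F.map_extend k S (Algebra.ofId k S) ((FGProj.lin f).baseChange k)
    ((FGProj.lin f).baseChange S) (fun x => by
      induction x using TensorProduct.induction_on with
      | zero => simp only [map_zero]
      | add x y hx hy => simp only [map_add, hx, hy]
      | tmul a x => simp) (1 ⊗ₜ x)
  have h' (z : k ⊗[k] F.obj W) : (Algebra.ofId k S).toLinearMap.rTensor (F.obj W) z =
      1 ⊗ₜ[k] TensorProduct.lid k (F.obj W) z := by
    induction z using TensorProduct.induction_on with
    | zero => simp only [map_zero, TensorProduct.tmul_zero]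
    | add x y hx hy => simp only [map_add, hx, hy, TensorProduct.tmul_add]
    | tmul a x => simp [Algebra.ofId_apply, Algebra.algebraMap_eq_smul_one, TensorProduct.smul_tmul]
  rw [h'] at h
  simpa using h

/-- The extension of scalars of a morphism of finitely generated projective modules. -/
abbrev extend {V W : FGProj k} (f : V ⟶ W) : S ⊗[k] V.obj →ₗ[S] S ⊗[k] W.obj :=
  (FGProj.lin f).baseChange S

theorem extend_comp {V W X : FGProj k} (f : V ⟶ W) (g : W ⟶ X) :
    extend S (f ≫ g) = extend S g ∘ₗ extend S f :=
  LinearMap.baseChange_comp _ _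

theorem extend_zero (V W : FGProj k) : extend S (0 : V ⟶ W) = 0 :=
  LinearMap.baseChange_zero

theorem extend_sum {ι : Type*} (s : Finset ι) {V W : FGProj k} (f : ι → (V ⟶ W)) :
    extend S (∑ i ∈ s, f i) = ∑ i ∈ s, extend S (f i) :=
  map_sum (AddMonoidHom.mk' (fun f : V ⟶ W => extend S f) fun _ _ => LinearMap.baseChange_add _ _)
    f s

/-- Maps defined over `S` need not come from morphisms of `FGProj k`, so the universal property of
the biproduct is rederived from `biproduct.total`. -/
theorem extend_biproduct_hom_ext {n : ℕ} {V : Fin n → FGProj k} {M : Type*} [AddCommGroup M]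
    [Module S M] {g h : S ⊗[k] (⨁ V).obj →ₗ[S] M}
    (H : ∀ j, g ∘ₗ extend S (biproduct.ι V j) = h ∘ₗ extend S (biproduct.ι V j)) : g = h := by
  have key (g : S ⊗[k] (⨁ V).obj →ₗ[S] M) :
      g = ∑ j, (g ∘ₗ extend S (biproduct.ι V j)) ∘ₗ extend S (biproduct.π V j) := by
    have h1 : extend S (𝟙 (⨁ V)) = LinearMap.id := LinearMap.baseChange_id
    conv_lhs => rw [← LinearMap.comp_id g, ← h1, ← biproduct.total, extend_sum]
    refine LinearMap.ext fun x => ?_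
    simp only [extend_comp, LinearMap.comp_apply, LinearMap.sum_apply, map_sum]
  rw [key g, key h]
  simp only [H]

/-- The direct sum of `n` copies of a morphism defined over `S`. -/
def copies (n : ℕ) {V W : FGProj k} (f : S ⊗[k] V.obj →ₗ[S] S ⊗[k] W.obj) :
    S ⊗[k] (⨁ fun _ : Fin n => V).obj →ₗ[S] S ⊗[k] (⨁ fun _ : Fin n => W).obj :=
  ∑ i, extend S (biproduct.ι (fun _ : Fin n => W) i) ∘ₗ f ∘ₗ
    extend S (biproduct.π (fun _ : Fin n => V) i)

variable {S}

theorem copies_comp_ι (n : ℕ) {V W : FGProj k} (f : S ⊗[k] V.obj →ₗ[S] S ⊗[k] W.obj)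
    (j : Fin n) :
    copies S n f ∘ₗ extend S (biproduct.ι (fun _ : Fin n => V) j) =
      extend S (biproduct.ι (fun _ : Fin n => W) j) ∘ₗ f := by
  have h1 : extend S (𝟙 V) = LinearMap.id := LinearMap.baseChange_id
  refine LinearMap.ext fun x => ?_
  have h2 (i : Fin n) : extend S (biproduct.π (fun _ : Fin n => V) i)
      (extend S (biproduct.ι (fun _ : Fin n => V) j) x) =
      extend S (biproduct.ι (fun _ : Fin n => V) j ≫ biproduct.π _ i) x := by
    rw [extend_comp, LinearMap.comp_apply]
  rw [LinearMap.comp_apply, copies, LinearMap.sum_apply, Finset.sum_eq_single j]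
  · rw [← LinearMap.comp_assoc, LinearMap.comp_apply, h2, biproduct.ι_π_self, h1,
      LinearMap.id_apply]
  · intro i _ hi
    rw [← LinearMap.comp_assoc, LinearMap.comp_apply, h2, biproduct.ι_π_ne _ hi.symm,
      extend_zero, LinearMap.zero_apply, map_zero]
  · exact fun h => absurd (Finset.mem_univ j) h

theorem fold_comp_copies (n : ℕ) {V W : FGProj k} (f : S ⊗[k] V.obj →ₗ[S] S ⊗[k] W.obj) :
    extend S (fold n W) ∘ₗ copies S n f = f ∘ₗ extend S (fold n V) := by
  apply extend_biproduct_hom_ext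
  intro j
  have h1 (V : FGProj k) : extend S (𝟙 V) = LinearMap.id := LinearMap.baseChange_id
  rw [LinearMap.comp_assoc, copies_comp_ι, ← LinearMap.comp_assoc, ← extend_comp,
    LinearMap.comp_assoc, ← extend_comp, fold, fold, biproduct.ι_desc, biproduct.ι_desc, h1, h1,
    LinearMap.comp_id, LinearMap.id_comp]

theorem forgetSummand_comp_copies (n : ℕ) {V W : FGProj k}
    (f : S ⊗[k] V.obj →ₗ[S] S ⊗[k] W.obj) (i : Fin n) :
    extend S (forgetSummand (fun _ : Fin n => W) i) ∘ₗ copies S n f =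
      copies S n f ∘ₗ extend S (forgetSummand (fun _ : Fin n => V) i) := by
  apply extend_biproduct_hom_ext
  intro j
  rw [LinearMap.comp_assoc, copies_comp_ι, ← LinearMap.comp_assoc, ← extend_comp,
    LinearMap.comp_assoc, ← extend_comp, ι_forgetSummand, ι_forgetSummand]
  split_ifs
  · rw [extend_zero, extend_zero, LinearMap.zero_comp, LinearMap.comp_zero]
  · rw [copies_comp_ι]

theorem crossProj_baseChange {n : ℕ} (V : Fin n → FGProj k) :
    (crossProj F.toFunctor V).baseChange S = ((List.finRange n).map fun i =>
      1 - F.map S (extend S (forgetSummand V i))).prod := by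
  have h := map_list_prod (Module.End.baseChangeHom k S (F.obj (⨁ V)))
    ((List.finRange n).map fun i => 1 - forgetEnd F.toFunctor V i)
  refine h.trans ?_
  rw [List.map_map]
  congr 2
  funext i
  rw [Function.comp_apply, map_sub, _root_.map_one, map_baseChange]
  rfl

/-- The map `F(V ⊕ ⋯ ⊕ V) ⟶ F(V)` whose image is the copolynomial filtration commutes with the
polynomial action of the morphisms. -/
theorem map_fold_crossProj {n : ℕ} {V W : FGProj k} (f : S ⊗[k] V.obj →ₗ[S] S ⊗[k] W.obj)
    (z : S ⊗[k] F.obj (⨁ fun _ : Fin n => V)) :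
    F.map S f (((F.toFunctor.map (fold n V)).hom ∘ₗ
        crossProj F.toFunctor fun _ : Fin n => V).baseChange S z) =
      ((F.toFunctor.map (fold n W)).hom ∘ₗ
        crossProj F.toFunctor fun _ : Fin n => W).baseChange S (F.map S (copies S n f) z) := by
  rw [LinearMap.baseChange_comp, LinearMap.baseChange_comp, crossProj_baseChange,
    crossProj_baseChange, ← map_baseChange, ← map_baseChange, LinearMap.comp_apply,
    LinearMap.comp_apply, ← LinearMap.comp_apply (F.map S f), ← F.map_comp, ← fold_comp_copies,
    F.map_comp, LinearMap.comp_apply]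
  congr 1
  -- Over `S` the projector is still a product of the `1 - F(e_i)`, so commuting with each `e_i` is
  -- enough.
  apply prod_one_sub_intertwine
  intro i x
  rw [← LinearMap.comp_apply, ← F.map_comp, ← forgetSummand_comp_copies, F.map_comp,
    LinearMap.comp_apply]

/-- Stability is checked on the generators `1 ⊗ x` with `x` in the range; `map_fold_crossProj` sends
them into the base change of the corresponding range. -/
theorem isStrictSubfunctor_copolynomial {n : ℕ} (hn : 0 < n) :
    F.IsStrictSubfunctor (copolynomial F.toFunctor n).carrier := by
  refine ⟨isHomogeneousFamily_copolynomial hn _ F.weight_isInternal fun {V W} f d x hx => ?_,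
    fun S _ _ V W f y hy => ?_⟩
  · have h := F.map_weight k ((FGProj.lin f).baseChange k) d
      (Submodule.tmul_mem_baseChange_of_mem (1 : k) hx)
    have h' : (F.weight W d).baseChange k ≤
        (F.weight W d).comap (TensorProduct.lid k (F.obj W)).toLinearMap := by
      rw [Submodule.baseChange_eq_span, Submodule.span_le]
      rintro _ ⟨y, hy, rfl⟩
      simpa using hy
    exact h' h
  · rw [copolynomial_carrier _ hn, Submodule.baseChange_eq_span] at hy
    induction hy using Submodule.span_induction with
    | mem y hy =>
      obtain ⟨_, ⟨x, rfl⟩, rfl⟩ := hy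
      have h := F.map_fold_crossProj f (1 ⊗ₜ x)
      rw [LinearMap.baseChange_tmul] at h
      rw [TensorProduct.mk_apply, h, copolynomial_carrier _ hn]
      generalize F.map S (copies S n f) (1 ⊗ₜ x) = z
      induction z using TensorProduct.induction_on with
      | zero => rw [map_zero]; exact Submodule.zero_mem _
      | add x y hx hy => rw [map_add]; exact add_mem hx hy
      | tmul s x =>
        rw [LinearMap.baseChange_tmul]
        exact Submodule.tmul_mem_baseChange_of_mem _ (LinearMap.mem_range_self _ _)
    | zero => rw [map_zero]; exact Submodule.zero_mem _
    | add x y _ _ hx hy => rw [map_add]; exact add_mem hx hy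
    | smul s x _ hx => rw [_root_.map_smul]; exact Submodule.smul_mem _ _ hx

end StrictAnalyticFunctor
end ExpFun

/-! ### The theorem in both settings -/

theorem mainTheorem7 :
    -- ordinary functors on an additive category
    (∀ {k : Type u} [CommRing k] {C : Type u₁} [Category.{v} C] [Preadditive C]
      [HasFiniteBiproducts C] (F : C ⥤ ModuleCat.{w} k) (E : ExpFun.ExponentialStructure F)
      (n : ℕ), 0 < n →
      ExpFun.IsHomogeneousFamily E.deg (E.augPow n).carrier ∧
      ExpFun.EMLDegreeLT (E.augPow n).quotient n ∧
      (∀ G : ExpFun.Subfun F, ExpFun.EMLDegreeLT G.quotient n → E.augPow n ≤ G) ∧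
      E.augPow n = ExpFun.copolynomial F n ∧
      ∀ E' : ExpFun.ExponentialStructure F, E'.augPow n = E.augPow n) ∧
    -- strict analytic functors
    (∀ {k : Type u} [CommRing k] (F : ExpFun.StrictAnalyticFunctor.{w} k)
      (E : ExpFun.StrictExponentialStructure F) (n : ℕ), 0 < n →
      F.IsStrictSubfunctor (E.augPow n).carrier ∧
      ExpFun.IsHomogeneousFamily E.deg (E.augPow n).carrier ∧
      ExpFun.EMLDegreeLT (E.augPow n).quotient n ∧
      (∀ G : ExpFun.Subfun F.toFunctor, F.IsStrictSubfunctor G.carrier →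
        ExpFun.EMLDegreeLT G.quotient n → E.augPow n ≤ G) ∧
      E.augPow n = ExpFun.copolynomial F.toFunctor n ∧
      ∀ E' : ExpFun.StrictExponentialStructure F, E'.augPow n = E.augPow n) := by
  refine ⟨fun F E n hn => ?_, fun F E n hn => ?_⟩
  · rw [E.augPow_eq_copolynomial hn]
    exact ⟨ExpFun.isHomogeneousFamily_copolynomial hn _ E.deg_isInternal E.deg_map,
      ExpFun.EMLDegreeLT_quotient_of_copolynomial_le hn _ le_rfl,
      fun G hG => ExpFun.copolynomial_le_of_EMLDegreeLT_quotient hn G hG, rfl,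
      fun E' => E'.augPow_eq_copolynomial hn⟩
  · rw [E.augPow_eq_copolynomial hn]
    exact ⟨F.isStrictSubfunctor_copolynomial hn,
      ExpFun.isHomogeneousFamily_copolynomial hn _ E.deg_isInternal E.deg_map,
      ExpFun.EMLDegreeLT_quotient_of_copolynomial_le hn _ le_rfl,
      fun G _ hG => ExpFun.copolynomial_le_of_EMLDegreeLT_quotient hn G hG, rfl,
      fun E' => E'.augPow_eq_copolynomial hn⟩


end
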